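/- Let $\Gamma$ be a finite distance-regular graph with vertex set $X$, path-length distance $\partial$, diameter $D\ge 3$ and intersection numbers $p^h_{ij}=|\{w\in X:\partial(y,w)=i,\ \partial(w,z)=j\}|$ (for any $y,z\in X$ with $\partial(y,z)=h$); put $b_1=p^1_{12}$. For $0\le i\le D$ let $A_i\in \mathrm{Mat}_X(\mathbb C)$ be the $i$th distance matrix, whose $(y,z)$ entry is $1$ if $\partial(y,z)=i$ and $0$ otherwise. Let $A=A_1$, let $J$ be the all-ones matrix, and let $\mathbf M$ be the subalgebra of $\mathrm{Mat}_X(\mathbb C)$ generated by $A$. Fix $x\in X$ and let $V=\mathbb C^X$ with the standard Hermitian inner product. For $0\le i\le D$ let $E_i^*$ be the diagonal matrix with $(y,y)$ entry $1$ if $\partial(x,y)=i$ and $0$ otherwise, and let $s_i\in V$ be the characteristic vector of $\{y:\partial(x,y)=i\}$. Let $\mathbf T$ be the subalgebra of $\mathrm{Mat}_X(\mathbb C)$ generated by $A,E_0^*,\dots,E_D^*$. A $\mathbf T$-module is a subspace $W\subseteq V$ with $\mathbf TW\subseteq W$; it is irreducible if $W\ne0$ and the only $\mathbf T$-modules contained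 in $W$ are $0$ and $W$. An irreducible $W$ is thin if $\dim E_i^*W\le 1$ for $0\le i\le D$, and its endpoint is the minimal $i$ with $E_i^*W\neq 0$. If $W$ is a thin irreducible $\mathbf T$-module with endpoint $1$, then its local eigenvalue is the scalar by which $E_1^*AE_1^*$ acts on the one-dimensional space $E_1^*W$. For $\theta\in\mathbb C$ let $\mathbf M(\theta)=\{Y\in\mathbf M:(A-\theta I)Y\in\mathbb CA_D\}$, and let $\mathbf M(\infty)=\mathbb CA_D$. A pseudo primitive idempotent for $\theta\in\mathbb C\cup\{\infty\}$ is a nonzero element of $\mathbf M(\theta)$. For $\eta\in\mathbb C$ put $\widetilde\eta=-1-\frac{b_1}{1+\eta}$ if $\eta\ne-1$, and $\widetilde\eta=\infty$ if $\eta=-1$. Theorem. Let $v$ be a nonzero vector in $E_1^*V$ which is orthogonal to $s_1$ and is contained in a thin irreducible $\mathbf T$-module $W$ with endpoint $1$. Let $\eta$ be the local eigenvalue of $W$, and let $E$ be any pseudo primitive idempotent for $\widetilde\eta$. Then $J,E$ form a basis of the vector space $$(\mathbf M;v)=\{P\in\mathbf M: Pv\in E_D^*V\}.$$ -/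

import Mathlib

open scoped Matrix OnePoint

noncomputable section

namespace SimpleGraph

variable {X : Type*}

/-- `G` is distance-regular with intersection numbers `p h i j = p^h_{ij}`: it is connected and, for
all `0 ≤ h, i, j ≤ D` (with `D` the diameter) and all vertices `y, z` at distance `h`, exactly
`p h i j` vertices `w` satisfy `∂(y,w) = i` and `∂(w,z) = j`. -/
def IsDistanceRegularWith [Fintype X] (G : SimpleGraph X) (p : ℕ → ℕ → ℕ → ℕ) : Prop :=
  G.Connected ∧
    ∀ h i j : ℕ, h ≤ G.diam → i ≤ G.diam → j ≤ G.diam → ∀ y z : X, G.dist y z = h →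
      Set.ncard {w : X | G.dist y w = i ∧ G.dist w z = j} = p h i j

/-- The `i`th distance matrix `A_i`; in particular `A_1` is the adjacency matrix `A`. -/
def distanceMatrix (G : SimpleGraph X) (i : ℕ) : Matrix X X ℂ :=
  Matrix.of fun y z => if G.dist y z = i then 1 else 0

/-- The Bose-Mesner algebra `M`, generated by the adjacency matrix. -/
def boseMesner [Fintype X] [DecidableEq X] (G : SimpleGraph X) : Subalgebra ℂ (Matrix X X ℂ) :=
  Algebra.adjoin ℂ {G.distanceMatrix 1}

/-- The `i`th dual idempotent `E*_i = E*_i(x)`. -/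
def dualIdempotent [DecidableEq X] (G : SimpleGraph X) (x : X) (i : ℕ) : Matrix X X ℂ :=
  Matrix.diagonal fun y => if G.dist x y = i then 1 else 0

/-- The image `E*_i W` of a subspace `W` of `V = ℂ^X`. -/
def dualComponent [Fintype X] [DecidableEq X] (G : SimpleGraph X) (x : X) (i : ℕ)
    (W : Submodule ℂ (X → ℂ)) : Submodule ℂ (X → ℂ) :=
  W.map (G.dualIdempotent x i).mulVecLin

/-- The vector `s_i`, the sum of `ŷ` over the vertices `y` with `∂(x,y) = i`. -/
def sphereVector (G : SimpleGraph X) (x : X) (i : ℕ) : X → ℂ :=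
  fun y => if G.dist x y = i then 1 else 0

/-- The Terwilliger (subconstituent) algebra `T = T(x)`, generated by `A, E*_0, …, E*_D`. -/
def terwilliger [Fintype X] [DecidableEq X] (G : SimpleGraph X) (x : X) :
    Subalgebra ℂ (Matrix X X ℂ) :=
  Algebra.adjoin ℂ ({G.distanceMatrix 1} ∪ {B | ∃ i ≤ G.diam, B = G.dualIdempotent x i})

/-- A `T`-module: a subspace `W` of `V` with `T W ⊆ W`. -/
def IsTModule [Fintype X] [DecidableEq X] (G : SimpleGraph X) (x : X)
    (W : Submodule ℂ (X → ℂ)) : Prop :=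
  ∀ B ∈ G.terwilliger x, ∀ w ∈ W, B *ᵥ w ∈ W

/-- An irreducible `T`-module: a nonzero `T`-module containing no `T`-modules but `0` and itself. -/
def IsIrreducibleTModule [Fintype X] [DecidableEq X] (G : SimpleGraph X) (x : X)
    (W : Submodule ℂ (X → ℂ)) : Prop :=
  G.IsTModule x W ∧ W ≠ ⊥ ∧
    ∀ U : Submodule ℂ (X → ℂ), U ≤ W → G.IsTModule x U → U = ⊥ ∨ U = W

/-- `W` has endpoint `r`: `r` is the minimal `i`, `0 ≤ i ≤ D`, with `E*_i W ≠ 0`. -/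
def HasEndpoint [Fintype X] [DecidableEq X] (G : SimpleGraph X) (x : X)
    (W : Submodule ℂ (X → ℂ)) (r : ℕ) : Prop :=
  IsLeast {i : ℕ | i ≤ G.diam ∧ G.dualComponent x i W ≠ ⊥} r

/-- `W` is thin: `dim E*_i W ≤ 1` for `0 ≤ i ≤ D`. -/
def IsThin [Fintype X] [DecidableEq X] (G : SimpleGraph X) (x : X)
    (W : Submodule ℂ (X → ℂ)) : Prop :=
  ∀ i ≤ G.diam, Module.finrank ℂ (G.dualComponent x i W) ≤ 1

/-- `η` is the local eigenvalue of `W`: the space `E*_1 W` is nonzero and `E*_1 A E*_1` acts on it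
as multiplication by `η`. -/
def IsLocalEigenvalue [Fintype X] [DecidableEq X] (G : SimpleGraph X) (x : X)
    (W : Submodule ℂ (X → ℂ)) (η : ℂ) : Prop :=
  G.dualComponent x 1 W ≠ ⊥ ∧
    ∀ w ∈ G.dualComponent x 1 W,
      (G.dualIdempotent x 1 * G.distanceMatrix 1 * G.dualIdempotent x 1) *ᵥ w = η • w

/-- The space `(M; v)` of all `P ∈ M` with `P v ∈ E*_D V`. -/
def boseMesnerSub [Fintype X] [DecidableEq X] (G : SimpleGraph X) (x : X) (v : X → ℂ) :
    Submodule ℂ (Matrix X X ℂ) where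
  carrier := {P | P ∈ G.boseMesner ∧ P *ᵥ v ∈ G.dualComponent x G.diam ⊤}
  zero_mem' := ⟨zero_mem _, by simp⟩
  add_mem' := fun {P Q} hP hQ => ⟨add_mem hP.1 hQ.1, by
    rw [Matrix.add_mulVec]; exact add_mem hP.2 hQ.2⟩
  smul_mem' := fun c P hP => ⟨Subalgebra.smul_mem _ hP.1 c, by
    rw [Matrix.smul_mulVec]; exact Submodule.smul_mem _ c hP.2⟩

/-- The space `M(θ)` for `θ ∈ ℂ`: all `Y ∈ M` with `(A - θ I) Y ∈ ℂ A_D`. -/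
def pseudoSpaceFinite [Fintype X] [DecidableEq X] (G : SimpleGraph X) (θ : ℂ) :
    Submodule ℂ (Matrix X X ℂ) where
  carrier := {Y | Y ∈ G.boseMesner ∧
    (G.distanceMatrix 1 - θ • (1 : Matrix X X ℂ)) * Y ∈ Submodule.span ℂ {G.distanceMatrix G.diam}}
  zero_mem' := ⟨zero_mem _, by simp⟩
  add_mem' := fun {P Q} hP hQ => ⟨add_mem hP.1 hQ.1, by
    rw [mul_add]; exact add_mem hP.2 hQ.2⟩
  smul_mem' := fun c P hP => ⟨Subalgebra.smul_mem _ hP.1 c, by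
    rw [mul_smul_comm]; exact Submodule.smul_mem _ c hP.2⟩

/-- The space `M(θ)` for `θ ∈ ℂ ∪ {∞}`, where `M(∞) = ℂ A_D`. -/
def pseudoSpace [Fintype X] [DecidableEq X] (G : SimpleGraph X) (θ : OnePoint ℂ) :
    Submodule ℂ (Matrix X X ℂ) :=
  θ.elim (Submodule.span ℂ {G.distanceMatrix G.diam}) fun t => G.pseudoSpaceFinite t

/-- A pseudo primitive idempotent for `θ ∈ ℂ ∪ {∞}`: a nonzero element of `M(θ)`. -/
def IsPseudoPrimitiveIdempotent [Fintype X] [DecidableEq X] (G : SimpleGraph X)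
    (θ : OnePoint ℂ) (E : Matrix X X ℂ) : Prop :=
  E ∈ G.pseudoSpace θ ∧ E ≠ 0

/-- The map `η ↦ η̃` on `ℂ ∪ {∞}`, depending on the intersection number `b₁`: it exchanges `-1`
and `∞`, and sends any other `η` to `-1 - b₁ / (1 + η)`. -/
def etaTilde (b₁ : ℕ) (η : OnePoint ℂ) : OnePoint ℂ :=
  η.elim ((-1 : ℂ) : OnePoint ℂ) fun t =>
    if t = -1 then ∞ else ((-1 - (b₁ : ℂ) / (1 + t) : ℂ) : OnePoint ℂ)

end SimpleGraph

end

/-! Every `P` in the Bose-Mesner algebra has entries `ρ (∂(y,z))`. Since `v` lives on the first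
sphere, `P v` on sphere `i + 1` involves only `A_i v`, `A_{i+1} v`, `A_{i+2} v`, and these sum to
zero there because `J v = 0`.

Dimension at most two: for `i + 1 < D` the vector `A_i v` is nonzero somewhere on sphere `i + 1`, so
the vanishing of `P v` there determines `ρ i` from `ρ (i+1)` and `ρ (i+2)`. Thus `ρ (D-1) = ρ D`
forces `P` to be a multiple of `J` (`coeff_const_of_mulVec_mem`).

Membership of `E`: for finite `η̃`, the choice of `η̃` makes `E v` vanish on sphere 1. As `(A - η̃)
E v` is a multiple of `A_D v`, which is zero before sphere `D - 1`, a first nonzero component of `E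
v` before sphere `D` would be killed by lowering, contradicting irreducibility and thinness. For `η
= -1` the same lowering argument applies to the vectors `A_i v`.

Independence: a nonzero multiple of `J` lies in `M(θ)` only if `θ` is the valency `k`. But `η̃ = k`
would make the algebraic integer `1 + η` equal to `-b₁/(k+1)`, which lies strictly between `-1` and
`0`. -/

namespace SimpleGraph

/-! ### Distances and geodesics. -/

variable {X : Type*} {G : SimpleGraph X} {p : ℕ → ℕ → ℕ → ℕ}

/-- A vertex on a shortest path at a prescribed distance from its start. -/
theorem Connected.exists_dist_eq_of_le_dist (hG : G.Connected) {y z : X} {j : ℕ}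
    (hj : j ≤ G.dist y z) : ∃ w, G.dist y w = j ∧ G.dist w z = G.dist y z - j := by
  obtain ⟨q, hq⟩ := hG.exists_walk_length_eq_dist y z
  have h1 := dist_le (q.take j)
  have h2 := dist_le (q.drop j)
  rw [Walk.take_length] at h1
  rw [Walk.drop_length] at h2
  have h3 := hG.dist_triangle (u := y) (v := q.getVert j) (w := z)
  exact ⟨q.getVert j, by omega, by omega⟩

/-- A geodesic triple with prescribed distances. -/
theorem Connected.exists_dist_eq_add (hG : G.Connected) {i j : ℕ} (h : i + j ≤ G.diam) :
    ∃ u w z, G.dist u w = i ∧ G.dist w z = j ∧ G.dist u z = i + j := by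
  have := hG.nonempty
  obtain ⟨a, b, hab⟩ := G.exists_dist_eq_diam
  obtain ⟨c, hc, -⟩ := hG.exists_dist_eq_of_le_dist (y := a) (z := b) (j := i + j) (by omega)
  obtain ⟨d, hd, hd'⟩ := hG.exists_dist_eq_of_le_dist (y := a) (z := c) (j := i) (by omega)
  exact ⟨a, d, c, hd, by omega, hc⟩

theorem Connected.distanceMatrix_zero [DecidableEq X] (hG : G.Connected) :
    G.distanceMatrix 0 = 1 := by
  ext y z
  simp [distanceMatrix, Matrix.one_apply, hG.dist_eq_zero_iff]

section Fintype

variable [Fintype X]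

theorem Connected.dist_le_diam_of_fintype (hG : G.Connected) (y z : X) :
    G.dist y z ≤ G.diam := by
  have := hG.nonempty
  exact dist_le_diam (connected_iff_ediam_ne_top.1 hG)

/-! ### Intersection numbers and products of distance matrices. -/

namespace IsDistanceRegularWith

theorem intersection_ne_zero (hG : G.IsDistanceRegularWith p) (y w z : X) :
    p (G.dist y z) (G.dist y w) (G.dist w z) ≠ 0 := by
  have hd := hG.1.dist_le_diam_of_fintype
  rw [← hG.2 _ _ _ (hd y z) (hd y w) (hd w z) y z rfl]
  exact Set.ncard_ne_zero_of_mem (a := w) ⟨rfl, rfl⟩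

theorem intersection_eq_zero (hG : G.IsDistanceRegularWith p) {h i j : ℕ} (hh : h ≤ G.diam)
    (hi : i ≤ G.diam) (hj : j ≤ G.diam) (hlt : h + i < j ∨ h + j < i ∨ i + j < h) :
    p h i j = 0 := by
  obtain ⟨y, z, -, hyz, -⟩ := hG.1.exists_dist_eq_add (i := h) (j := 0) (by omega)
  rw [← hG.2 h i j hh hi hj y z hyz, Set.ncard_eq_zero]
  ext w
  simp only [Set.mem_ofPred_eq, Set.mem_empty_iff_false, iff_false, not_and]
  intro h1 h2
  have a := hG.1.dist_triangle (u := y) (v := w) (w := z)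
  have b := hG.1.dist_triangle (u := w) (v := y) (w := z)
  have c := hG.1.dist_triangle (u := y) (v := z) (w := w)
  rw [dist_comm (u := w) (v := y)] at b
  rw [dist_comm (u := z) (v := w)] at c
  omega

theorem intersection_add_left_ne_zero (hG : G.IsDistanceRegularWith p) {i j : ℕ}
    (h : i + j ≤ G.diam) : p (i + j) i j ≠ 0 := by
  obtain ⟨u, w, z, h1, h2, h3⟩ := hG.1.exists_dist_eq_add h
  simpa [h1, h2, h3] using hG.intersection_ne_zero u w z

theorem intersection_add_right_ne_zero (hG : G.IsDistanceRegularWith p) {i j : ℕ}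
    (h : i + j ≤ G.diam) : p i j (i + j) ≠ 0 := by
  obtain ⟨u, w, z, h1, h2, h3⟩ := hG.1.exists_dist_eq_add h
  have := hG.intersection_ne_zero w z u
  rwa [dist_comm (u := z) (v := u), dist_comm (u := w) (v := u), h1, h2, h3] at this

theorem sum_ite_dist (hG : G.IsDistanceRegularWith p) {i j : ℕ} (hi : i ≤ G.diam)
    (hj : j ≤ G.diam) (y z : X) :
    ∑ w, (if G.dist y w = i ∧ G.dist w z = j then 1 else 0 : ℂ) = p (G.dist y z) i j := by
  classical
  rw [← hG.2 _ i j (hG.1.dist_le_diam_of_fintype y z) hi hj y z rfl, Finset.sum_boole,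
    Set.ncard_eq_toFinset_card', Set.toFinset_ofPred]

/-- The right side sees `y, z` only through their distance, so matrices with distance-dependent
entries are closed under multiplication. -/
theorem sum_mul_dist (hG : G.IsDistanceRegularWith p) (f g : ℕ → ℂ) (y z : X) :
    ∑ w, f (G.dist y w) * g (G.dist w z) =
      ∑ i ∈ Finset.range (G.diam + 1), ∑ j ∈ Finset.range (G.diam + 1),
        f i * g j * p (G.dist y z) i j := by
  have hd := hG.1.dist_le_diam_of_fintype
  have key : ∀ w, f (G.dist y w) * g (G.dist w z) =
      ∑ i ∈ Finset.range (G.diam + 1), ∑ j ∈ Finset.range (G.diam + 1),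
        f i * g j * (if G.dist y w = i ∧ G.dist w z = j then 1 else 0) := by
    intro w
    rw [Finset.sum_eq_single_of_mem (G.dist y w) (by simpa [Nat.lt_succ_iff] using hd y w),
      Finset.sum_eq_single_of_mem (G.dist w z) (by simpa [Nat.lt_succ_iff] using hd w z)]
    · simp
    · intro j _ hj
      simp [hj.symm]
    · intro i _ hi
      simp [hi.symm]
  simp_rw [key]
  rw [Finset.sum_comm]
  refine Finset.sum_congr rfl fun i hi => ?_
  rw [Finset.sum_comm]
  refine Finset.sum_congr rfl fun j hj => ?_
  rw [← Finset.mul_sum, hG.sum_ite_dist (by simpa [Nat.lt_succ_iff] using hi)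
    (by simpa [Nat.lt_succ_iff] using hj)]

theorem distanceMatrix_mul_apply (hG : G.IsDistanceRegularWith p) {i j : ℕ} (hi : i ≤ G.diam)
    (hj : j ≤ G.diam) (y z : X) :
    (G.distanceMatrix i * G.distanceMatrix j) y z = p (G.dist y z) i j := by
  rw [← hG.sum_ite_dist hi hj, Matrix.mul_apply]
  refine Finset.sum_congr rfl fun w _ => ?_
  simp only [distanceMatrix, Matrix.of_apply, ite_and]
  split_ifs <;> simp

theorem distanceMatrix_mul (hG : G.IsDistanceRegularWith p) {i j : ℕ} (hi : i ≤ G.diam)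
    (hj : j ≤ G.diam) : G.distanceMatrix i * G.distanceMatrix j =
      ∑ h ∈ Finset.range (G.diam + 1), (p h i j : ℂ) • G.distanceMatrix h := by
  ext y z
  rw [hG.distanceMatrix_mul_apply hi hj, Matrix.sum_apply]
  rw [Finset.sum_eq_single_of_mem (G.dist y z)
    (by simpa [Nat.lt_succ_iff] using hG.1.dist_le_diam_of_fintype y z)]
  · simp [distanceMatrix]
  · intro h _ hne
    simp [distanceMatrix, hne.symm]

theorem distanceMatrix_mulVec_mulVec (hG : G.IsDistanceRegularWith p) {i j : ℕ}
    (hi : i ≤ G.diam) (hj : j ≤ G.diam) (v : X → ℂ) (y : X) :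
    (G.distanceMatrix i *ᵥ (G.distanceMatrix j *ᵥ v)) y =
      ∑ h ∈ Finset.range (G.diam + 1), (p h i j : ℂ) * (G.distanceMatrix h *ᵥ v) y := by
  rw [Matrix.mulVec_mulVec, hG.distanceMatrix_mul hi hj, Matrix.sum_mulVec, Finset.sum_apply]
  simp [Matrix.smul_mulVec]

/-- The three terms of a row of `A P` at vertices at distance at most one. -/
theorem sum_dist_one_mul (hG : G.IsDistanceRegularWith p) (hD : 2 ≤ G.diam) (ρ : ℕ → ℂ)
    {y z : X} (hyz : G.dist y z ≤ 1) :
    ∑ w, G.distanceMatrix 1 y w * ρ (G.dist w z) =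
      p (G.dist y z) 1 0 * ρ 0 + p (G.dist y z) 1 1 * ρ 1 + p (G.dist y z) 1 2 * ρ 2 := by
  have h := hG.sum_mul_dist (fun i => if i = 1 then 1 else 0) ρ y z
  simp only [distanceMatrix, Matrix.of_apply]
  rw [h, Finset.sum_eq_single_of_mem 1 (by simp; omega) (by intro i _ hi; simp [hi]),
    ← Finset.sum_subset (s₁ := Finset.range 3)]
  · simp [Finset.sum_range_succ]
    ring
  · intro i hi
    have := Finset.mem_range.1 hi
    exact Finset.mem_range.2 (by omega)
  · intro i hi hi'
    simp only [Finset.mem_range] at hi hi'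
    rw [hG.intersection_eq_zero (by omega) (by omega) (by omega) (by omega)]
    simp

theorem intersection_one_one_zero (hG : G.IsDistanceRegularWith p) (hD : 1 ≤ G.diam) :
    p 1 1 0 = 1 := by
  obtain ⟨y, z, -, hyz, -⟩ := hG.1.exists_dist_eq_add (i := 1) (j := 0) (by omega)
  rw [← hG.2 1 1 0 hD hD (by omega) y z hyz, Set.ncard_eq_one]
  refine ⟨z, ?_⟩
  ext w
  simp only [Set.mem_ofPred_eq, Set.mem_singleton_iff, hG.1.dist_eq_zero_iff]
  exact ⟨fun h => h.2, fun h => ⟨h ▸ hyz, h⟩⟩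

theorem sum_distanceMatrix_one (hG : G.IsDistanceRegularWith p) (hD : 2 ≤ G.diam) (y : X) :
    ∑ w, G.distanceMatrix 1 y w = p 0 1 1 := by
  have := hG.sum_dist_one_mul hD (fun _ => 1) (y := y) (z := y) (by simp)
  rw [dist_self, hG.intersection_eq_zero (h := 0) (i := 1) (j := 0) (by omega) (by omega)
    (by omega) (by omega), hG.intersection_eq_zero (h := 0) (i := 1) (j := 2) (by omega)
    (by omega) (by omega) (by omega)] at this
  simpa using this

/-- For adjacent `y, z`, the neighbours of `y` are at distance 0, 1 or 2 from `z`. -/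
theorem valency_eq (hG : G.IsDistanceRegularWith p) (hD : 2 ≤ G.diam) :
    p 0 1 1 = 1 + p 1 1 1 + p 1 1 2 := by
  obtain ⟨y, z, -, hyz, -⟩ := hG.1.exists_dist_eq_add (i := 1) (j := 0) (by omega)
  have := hG.sum_dist_one_mul hD (fun _ => 1) (y := y) (z := z) (by omega)
  simp only [mul_one, hyz, hG.sum_distanceMatrix_one hD,
    hG.intersection_one_one_zero (by omega)] at this
  exact_mod_cast this

/-! ### The Bose-Mesner algebra and distance-dependent matrices. -/

variable [DecidableEq X]

/-- In `A A_{i+1}` the highest term is `A_{i+2}`, with nonzero coefficient; solve for it. -/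
theorem distanceMatrix_mem_boseMesner (hG : G.IsDistanceRegularWith p) (i : ℕ)
    (hi : i ≤ G.diam) : G.distanceMatrix i ∈ G.boseMesner := by
  induction i using Nat.strong_induction_on with
  | _ i ih =>
  rcases i with _ | _ | i
  · rw [hG.1.distanceMatrix_zero]
    exact one_mem _
  · exact Algebra.subset_adjoin rfl
  · have hmul : G.distanceMatrix 1 * G.distanceMatrix (i + 1) ∈ G.boseMesner :=
      mul_mem (Algebra.subset_adjoin rfl) (ih (i + 1) (by omega) (by omega))
    rw [hG.distanceMatrix_mul (by omega) (by omega),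
      ← Finset.sum_subset (s₁ := Finset.range (i + 3)), Finset.sum_range_succ] at hmul
    · have hsum : ∑ h ∈ Finset.range (i + 2), (p h 1 (i + 1) : ℂ) • G.distanceMatrix h ∈
          G.boseMesner := by
        refine sum_mem fun h hh => Subalgebra.smul_mem _ (ih h ?_ ?_) _
        · have := Finset.mem_range.1 hh
          omega
        · have := Finset.mem_range.1 hh
          omega
      have h2 := (add_mem_cancel_left hsum).1 hmul
      have hne : (p (i + 2) 1 (i + 1) : ℂ) ≠ 0 := by
        have := hG.intersection_add_left_ne_zero (i := 1) (j := i + 1) (by omega)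
        rw [show 1 + (i + 1) = i + 2 by ring] at this
        exact_mod_cast this
      have h3 := Subalgebra.smul_mem _ h2 (p (i + 2) 1 (i + 1) : ℂ)⁻¹
      rwa [smul_smul, inv_mul_cancel₀ hne, one_smul] at h3
    · intro h hh
      have := Finset.mem_range.1 hh
      exact Finset.mem_range.2 (by omega)
    · intro h hh hh'
      simp only [Finset.mem_range] at hh hh'
      rw [hG.intersection_eq_zero (by omega) (by omega) (by omega) (by omega)]
      simp

theorem exists_eq_dist_of_mem_boseMesner (hG : G.IsDistanceRegularWith p) {P : Matrix X X ℂ}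
    (hP : P ∈ G.boseMesner) : ∃ ρ : ℕ → ℂ, ∀ y z, P y z = ρ (G.dist y z) := by
  induction hP using Algebra.adjoin_induction with
  | mem x hx =>
    obtain rfl := hx
    exact ⟨fun h => if h = 1 then 1 else 0, fun y z => rfl⟩
  | algebraMap r =>
    refine ⟨fun h => if h = 0 then r else 0, fun y z => ?_⟩
    simp [Matrix.algebraMap_matrix_apply, hG.1.dist_eq_zero_iff]
  | add P Q _ _ hP hQ =>
    obtain ⟨f, hf⟩ := hP
    obtain ⟨g, hg⟩ := hQ
    exact ⟨f + g, fun y z => by simp [hf, hg]⟩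
  | mul P Q _ _ hP hQ =>
    obtain ⟨f, hf⟩ := hP
    obtain ⟨g, hg⟩ := hQ
    refine ⟨fun h => ∑ i ∈ Finset.range (G.diam + 1), ∑ j ∈ Finset.range (G.diam + 1),
        f i * g j * p h i j, fun y z => ?_⟩
    simp only [Matrix.mul_apply, hf, hg]
    exact hG.sum_mul_dist f g y z

theorem allOnes_mem_boseMesner (hG : G.IsDistanceRegularWith p) :
    (Matrix.of fun _ _ => 1 : Matrix X X ℂ) ∈ G.boseMesner := by
  have : (Matrix.of fun _ _ => 1 : Matrix X X ℂ) =
      ∑ i ∈ Finset.range (G.diam + 1), G.distanceMatrix i := by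
    ext y z
    simp [distanceMatrix, Matrix.sum_apply, hG.1.dist_le_diam_of_fintype y z]
  rw [this]
  exact sum_mem fun i hi => hG.distanceMatrix_mem_boseMesner i
    (by simpa [Nat.lt_succ_iff] using hi)

/-- The first two steps of the three-term recurrence satisfied by the coefficients of an element
of `M(θ)`, in the form of a relation between consecutive differences. -/
theorem pseudo_recurrence (hG : G.IsDistanceRegularWith p) (hD : 3 ≤ G.diam) {θ : ℂ}
    {P : Matrix X X ℂ} (hP : P ∈ G.pseudoSpaceFinite θ) {ρ : ℕ → ℂ}
    (hρ : ∀ y z, P y z = ρ (G.dist y z)) :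
    (p 1 1 2 : ℂ) * (ρ 2 - ρ 1) = (θ + 1) * (ρ 1 - ρ 0) := by
  obtain ⟨-, hspan⟩ := hP
  obtain ⟨c, hc⟩ := Submodule.mem_span_singleton.1 hspan
  have hrow : ∀ y z, G.dist y z ≤ 1 →
      ∑ w, G.distanceMatrix 1 y w * ρ (G.dist w z) = θ * ρ (G.dist y z) := by
    intro y z hyz
    have h := congrFun (congrFun hc y) z
    rw [sub_mul, smul_mul_assoc, one_mul] at h
    simp only [Matrix.smul_apply, Matrix.sub_apply, Matrix.mul_apply, hρ, smul_eq_mul] at h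
    have hne : G.dist y z ≠ G.diam := by omega
    rw [distanceMatrix, Matrix.of_apply, if_neg hne, mul_zero] at h
    linear_combination -h
  obtain ⟨y, z, -, hyz, -⟩ := hG.1.exists_dist_eq_add (i := 1) (j := 0) (by omega)
  have h1 := hrow y z (by omega)
  have h0 := hrow y y (by simp)
  rw [hG.sum_dist_one_mul (by omega) ρ (by omega), hyz,
    hG.intersection_one_one_zero (by omega)] at h1
  rw [hG.sum_dist_one_mul (by omega) ρ (by simp), dist_self,
    hG.intersection_eq_zero (h := 0) (i := 1) (j := 0) (by omega) (by omega)
    (by omega) (by omega), hG.intersection_eq_zero (h := 0) (i := 1) (j := 2) (by omega)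
    (by omega) (by omega) (by omega)] at h0
  rw [hG.valency_eq (by omega)] at h0
  push_cast at h0 h1
  -- With `k = 1 + a₁ + b₁`, the two rows read `k ρ₁ = θ ρ₀` and `ρ₀ + a₁ ρ₁ + b₁ ρ₂ = θ ρ₁`.
  linear_combination h1 - h0

end IsDistanceRegularWith

end Fintype

end SimpleGraph

/-! ### Raising and lowering in thin irreducible `T`-modules. -/

namespace SimpleGraph

variable {X : Type*} [Fintype X] {G : SimpleGraph X}

theorem distanceMatrix_mulVec_congr {i : ℕ} {u w : X → ℂ} {y : X}
    (h : ∀ z, G.dist y z = i → u z = w z) :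
    (G.distanceMatrix i *ᵥ u) y = (G.distanceMatrix i *ᵥ w) y := by
  refine Finset.sum_congr rfl fun z _ => ?_
  by_cases hz : G.dist y z = i
  · rw [h z hz]
  · simp [distanceMatrix, hz]

theorem distanceMatrix_mulVec_eq_zero {i : ℕ} {w : X → ℂ} {y : X}
    (h : ∀ z, G.dist y z = i → w z = 0) : (G.distanceMatrix i *ᵥ w) y = 0 := by
  rw [distanceMatrix_mulVec_congr (w := 0) h, Matrix.mulVec_zero, Pi.zero_apply]

variable [DecidableEq X] {x : X} {W : Submodule ℂ (X → ℂ)}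

theorem dualIdempotent_mulVec_apply (i : ℕ) (w : X → ℂ) (y : X) :
    (G.dualIdempotent x i *ᵥ w) y = if G.dist x y = i then w y else 0 := by
  simp [dualIdempotent, Matrix.mulVec_diagonal]

theorem mem_dualComponent_top {i : ℕ} {w : X → ℂ} :
    w ∈ G.dualComponent x i ⊤ ↔ ∀ y, G.dist x y ≠ i → w y = 0 := by
  constructor
  · rintro ⟨u, -, rfl⟩ y hy
    rw [Matrix.mulVecLin_apply, dualIdempotent_mulVec_apply, if_neg hy]
  · refine fun h => ⟨w, trivial, ?_⟩
    ext y
    rw [Matrix.mulVecLin_apply, dualIdempotent_mulVec_apply]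
    split_ifs with hy
    · rfl
    · exact (h y hy).symm

theorem dualIdempotent_mulVec_mem (hW : G.IsTModule x W) {i : ℕ} (hi : i ≤ G.diam) {w : X → ℂ}
    (hw : w ∈ W) : G.dualIdempotent x i *ᵥ w ∈ W :=
  hW _ (Algebra.subset_adjoin (Or.inr ⟨i, hi, rfl⟩)) w hw

theorem mulVec_mem_of_mem_boseMesner (hW : G.IsTModule x W) {P : Matrix X X ℂ}
    (hP : P ∈ G.boseMesner) {w : X → ℂ} (hw : w ∈ W) : P *ᵥ w ∈ W :=
  hW P (Algebra.adjoin_mono Set.subset_union_left hP) w hw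

/-- Stability under the generators of `T` suffices for a `T`-module. -/
theorem isTModule_of_generators (hA : ∀ w ∈ W, G.distanceMatrix 1 *ᵥ w ∈ W)
    (hE : ∀ i ≤ G.diam, ∀ w ∈ W, G.dualIdempotent x i *ᵥ w ∈ W) : G.IsTModule x W := by
  intro B hB
  induction hB using Algebra.adjoin_induction with
  | mem B hB =>
    rcases hB with rfl | ⟨i, hi, rfl⟩
    · exact hA
    · exact hE i hi
  | algebraMap r =>
    intro w hw
    rw [Algebra.algebraMap_eq_smul_one, Matrix.smul_mulVec, Matrix.one_mulVec]
    exact W.smul_mem r hw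
  | add P Q _ _ hP hQ =>
    intro w hw
    rw [Matrix.add_mulVec]
    exact add_mem (hP w hw) (hQ w hw)
  | mul P Q _ _ hP hQ =>
    intro w hw
    rw [← Matrix.mulVec_mulVec]
    exact hP _ (hQ w hw)

/-- The vectors of `W` that vanish at all vertices whose distance from `x` satisfies `S`. -/
def vanishingOn (G : SimpleGraph X) (x : X) (W : Submodule ℂ (X → ℂ)) (S : ℕ → Prop) :
    Submodule ℂ (X → ℂ) where
  carrier := {w | w ∈ W ∧ ∀ y, S (G.dist x y) → w y = 0}
  zero_mem' := ⟨zero_mem _, fun _ _ => rfl⟩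
  add_mem' := fun ha hb => ⟨add_mem ha.1 hb.1, fun y hy => by
    rw [Pi.add_apply, ha.2 y hy, hb.2 y hy, add_zero]⟩
  smul_mem' := fun c _ ha => ⟨W.smul_mem c ha.1, fun y hy => by
    rw [Pi.smul_apply, ha.2 y hy, smul_zero]⟩

/-- In an irreducible module a nonzero subspace cut out by vanishing conditions on spheres is
everything as soon as it is stable under the adjacency matrix. -/
theorem IsIrreducibleTModule.vanishingOn_eq (hW : G.IsIrreducibleTModule x W) {S : ℕ → Prop}
    (hA : ∀ w ∈ W, (∀ y, S (G.dist x y) → w y = 0) →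
      ∀ y, S (G.dist x y) → (G.distanceMatrix 1 *ᵥ w) y = 0)
    {u : X → ℂ} (hu : u ∈ W) (hu0 : u ≠ 0) (huS : ∀ y, S (G.dist x y) → u y = 0) :
    ∀ w ∈ W, ∀ y, S (G.dist x y) → w y = 0 := by
  have hT : G.IsTModule x (G.vanishingOn x W S) := by
    refine isTModule_of_generators (fun w hw => ⟨?_, hA w hw.1 hw.2⟩)
      fun i hi w hw => ⟨dualIdempotent_mulVec_mem hW.1 hi hw.1, fun y hy => ?_⟩
    · exact hW.1 _ (Algebra.subset_adjoin (Or.inl rfl)) w hw.1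
    · rw [dualIdempotent_mulVec_apply, hw.2 y hy, ite_self]
  rcases hW.2.2 _ (fun w (hw : w ∈ G.vanishingOn x W S) => hw.1) hT with h | h
  · exact absurd ((Submodule.eq_bot_iff _).1 h u ⟨hu, huS⟩) hu0
  · intro w hw
    exact (h.ge hw).2

/-- In a thin module, any two vectors are proportional on each sphere on which the first one does
not vanish. -/
theorem IsThin.exists_smul (hthin : G.IsThin x W) {i : ℕ} (hi : i ≤ G.diam) {u w : X → ℂ}
    (hu : u ∈ W) (hw : w ∈ W) {y₀ : X} (hy₀ : G.dist x y₀ = i) (hne : u y₀ ≠ 0) :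
    ∃ c : ℂ, ∀ y, G.dist x y = i → w y = c * u y := by
  obtain ⟨e, he⟩ := finrank_le_one_iff.1 (hthin i hi)
  obtain ⟨a, ha⟩ := he ⟨_, u, hu, rfl⟩
  obtain ⟨b, hb⟩ := he ⟨_, w, hw, rfl⟩
  have ha' : ∀ y, G.dist x y = i → u y = a * (e : X → ℂ) y := by
    intro y hy
    have : a * (e : X → ℂ) y = (G.dualIdempotent x i *ᵥ u) y :=
      congrFun (congrArg Subtype.val ha) y
    rw [dualIdempotent_mulVec_apply, if_pos hy] at this
    exact this.symm
  have hb' : ∀ y, G.dist x y = i → w y = b * (e : X → ℂ) y := by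
    intro y hy
    have : b * (e : X → ℂ) y = (G.dualIdempotent x i *ᵥ w) y :=
      congrFun (congrArg Subtype.val hb) y
    rw [dualIdempotent_mulVec_apply, if_pos hy] at this
    exact this.symm
  have ha0 : a ≠ 0 := by
    rintro rfl
    exact hne (by rw [ha' y₀ hy₀, zero_mul])
  refine ⟨b / a, fun y hy => ?_⟩
  rw [ha' y hy, hb' y hy]
  field_simp

/-- The adjacency matrix lowers injectively within a thin irreducible module of endpoint one. -/
theorem IsIrreducibleTModule.eq_zero_of_lowering (hG : G.Connected)
    (hW : G.IsIrreducibleTModule x W) (hthin : G.IsThin x W) {m : ℕ}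
    (hend : ∃ u ∈ W, ∃ y, G.dist x y ≤ m ∧ u y ≠ 0) {w : X → ℂ} (hw : w ∈ W)
    (hw0 : ∀ y, G.dist x y ≤ m → w y = 0)
    (hAw : ∀ y, G.dist x y = m → (G.distanceMatrix 1 *ᵥ w) y = 0) :
    ∀ y, G.dist x y = m + 1 → w y = 0 := by
  by_contra! hne
  obtain ⟨y₀, hy₀, hne⟩ := hne
  have hle : m + 1 ≤ G.diam := hy₀ ▸ hG.dist_le_diam_of_fintype x y₀
  obtain ⟨u, hu, y, hy, huy⟩ := hend
  -- If `w` survives on sphere `m + 1`, thinness makes every vector of `W` vanishing up to sphere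
  -- `m` agree on sphere `m + 1` with a multiple of `w`, so `A` maps none of them back to sphere
  -- `m`. These vectors form a nonzero submodule, hence all of `W`, which `u` contradicts.
  refine huy (hW.vanishingOn_eq (S := fun i => i ≤ m) ?_ hw ?_ hw0 u hu y hy)
  · intro u hu hu0 y hy
    obtain ⟨c, hc⟩ := hthin.exists_smul hle hw hu hy₀ hne
    have hcongr : (G.distanceMatrix 1 *ᵥ u) y = (G.distanceMatrix 1 *ᵥ (c • w)) y := by
      refine distanceMatrix_mulVec_congr fun z hz => ?_
      have := hG.dist_triangle (u := x) (v := y) (w := z)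
      rcases Nat.lt_or_ge m (G.dist x z) with h | h
      · exact hc z (by omega)
      · rw [Pi.smul_apply, hu0 z h, hw0 z h, smul_zero]
    rw [hcongr, Matrix.mulVec_smul, Pi.smul_apply]
    rcases Nat.lt_or_ge (G.dist x y) m with h | h
    · rw [distanceMatrix_mulVec_eq_zero, smul_zero]
      intro z hz
      have := hG.dist_triangle (u := x) (v := y) (w := z)
      exact hw0 z (by omega)
    · rw [hAw y (by omega), smul_zero]
  · rintro rfl
    exact hne rfl

/-- If the adjacency matrix fails to raise the top component of a vector of a thin irreducible
module, then the whole module vanishes beyond that component. -/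
theorem IsIrreducibleTModule.eq_zero_of_raising (hG : G.Connected)
    (hW : G.IsIrreducibleTModule x W) (hthin : G.IsThin x W) {m : ℕ} {w : X → ℂ} (hw : w ∈ W)
    (hw0 : ∀ y, m < G.dist x y → w y = 0) {y₀ : X} (hy₀ : G.dist x y₀ = m) (hne : w y₀ ≠ 0)
    (hAw : ∀ y, G.dist x y = m + 1 → (G.distanceMatrix 1 *ᵥ w) y = 0) :
    ∀ u ∈ W, ∀ y, m < G.dist x y → u y = 0 := by
  -- Dually, vectors vanishing beyond sphere `m` are multiples of `w` on sphere `m`, so `A` does not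
  -- raise them.
  refine hW.vanishingOn_eq (S := fun i => m < i) ?_ hw ?_ hw0
  · intro u hu hu0 y hy
    obtain ⟨c, hc⟩ := hthin.exists_smul (hy₀ ▸ hG.dist_le_diam_of_fintype x y₀) hw hu hy₀ hne
    have htri : ∀ z, G.dist y z = 1 → G.dist x y ≤ G.dist x z + 1 := by
      intro z hz
      have := hG.dist_triangle (u := x) (v := z) (w := y)
      rwa [dist_comm (u := z), hz] at this
    have hcongr : (G.distanceMatrix 1 *ᵥ u) y = (G.distanceMatrix 1 *ᵥ (c • w)) y := by
      refine distanceMatrix_mulVec_congr fun z hz => ?_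
      have := htri z hz
      rcases Nat.lt_or_ge m (G.dist x z) with h | h
      · rw [Pi.smul_apply, hu0 z h, hw0 z h, smul_zero]
      · exact hc z (by omega)
    rw [hcongr, Matrix.mulVec_smul, Pi.smul_apply]
    rcases Nat.lt_or_ge (m + 1) (G.dist x y) with h | h
    · rw [distanceMatrix_mulVec_eq_zero, smul_zero]
      intro z hz
      have := htri z hz
      exact hw0 z (by omega)
    · rw [hAw y (by omega), smul_zero]
  · rintro rfl
    exact hne rfl

end SimpleGraph

/-! ### Vectors on the first sphere with zero sum. -/

namespace SimpleGraph

variable {X : Type*} [Fintype X] {G : SimpleGraph X} {p : ℕ → ℕ → ℕ → ℕ} {x : X} {v : X → ℂ}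

theorem Connected.distanceMatrix_mulVec_eq_zero_of_far (hG : G.Connected)
    (hv : ∀ z, G.dist x z ≠ 1 → v z = 0) {i : ℕ} {y : X}
    (h : G.dist x y + 1 < i ∨ i + 1 < G.dist x y) : (G.distanceMatrix i *ᵥ v) y = 0 := by
  refine distanceMatrix_mulVec_eq_zero fun z hz => hv z fun hxz => ?_
  have a := hG.dist_triangle (u := x) (v := z) (w := y)
  have b := hG.dist_triangle (u := y) (v := x) (w := z)
  rw [dist_comm (u := z)] at a
  rw [dist_comm (u := y) (v := x)] at b
  omega

theorem distanceMatrix_mulVec_center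
    (hv : ∀ z, G.dist x z ≠ 1 → v z = 0) (hsum : ∑ z, v z = 0) (i : ℕ) :
    (G.distanceMatrix i *ᵥ v) x = 0 := by
  by_cases hi : i = 1
  · subst hi
    rw [← hsum]
    refine Finset.sum_congr rfl fun z _ => ?_
    by_cases hz : G.dist x z = 1
    · simp [distanceMatrix, hz]
    · simp [distanceMatrix, hz, hv z hz]
  · refine distanceMatrix_mulVec_eq_zero fun z hz => hv z ?_
    rwa [hz]

/-- A distance-dependent matrix applied to a vector supported on the first sphere involves only
three distances. -/
theorem Connected.mulVec_apply_of_dist (hG : G.Connected)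
    (hv : ∀ z, G.dist x z ≠ 1 → v z = 0) {P : Matrix X X ℂ} {ρ : ℕ → ℂ}
    (hρ : ∀ y z, P y z = ρ (G.dist y z)) {i : ℕ} {y : X} (hy : G.dist x y = i + 1) :
    (P *ᵥ v) y = ρ i * (G.distanceMatrix i *ᵥ v) y +
      ρ (i + 1) * (G.distanceMatrix (i + 1) *ᵥ v) y +
      ρ (i + 2) * (G.distanceMatrix (i + 2) *ᵥ v) y := by
  simp only [Matrix.mulVec, dotProduct, Finset.mul_sum, ← Finset.sum_add_distrib]
  refine Finset.sum_congr rfl fun z _ => ?_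
  by_cases hxz : G.dist x z = 1
  · have a := hG.dist_triangle (u := x) (v := z) (w := y)
    have b := hG.dist_triangle (u := y) (v := x) (w := z)
    rw [dist_comm (u := z)] at a
    rw [dist_comm (u := y) (v := x)] at b
    have c : G.dist y z = i ∨ G.dist y z = i + 1 ∨ G.dist y z = i + 2 := by omega
    rcases c with c | c | c <;> simp [hρ, distanceMatrix, c]
  · simp [hv z hxz]

theorem Connected.distanceMatrix_mulVec_add_eq_zero (hG : G.Connected)
    (hv : ∀ z, G.dist x z ≠ 1 → v z = 0) (hsum : ∑ z, v z = 0) {i : ℕ} {y : X}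
    (hy : G.dist x y = i + 1) :
    (G.distanceMatrix i *ᵥ v) y + (G.distanceMatrix (i + 1) *ᵥ v) y +
      (G.distanceMatrix (i + 2) *ᵥ v) y = 0 := by
  have h := hG.mulVec_apply_of_dist hv (P := Matrix.of fun _ _ => 1) (ρ := fun _ => 1)
    (fun _ _ => rfl) hy
  simp only [one_mul] at h
  rw [← h, ← hsum]
  simp [Matrix.mulVec, dotProduct]

/-- A local eigenvalue is an algebraic integer. -/
theorem isIntegral_of_mulVec_eq {η : ℂ} (hv : ∀ z, G.dist x z ≠ 1 → v z = 0) (hv0 : v ≠ 0)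
    (hη : ∀ y, G.dist x y = 1 → (G.distanceMatrix 1 *ᵥ v) y = η * v y) : IsIntegral ℤ η := by
  -- The entries of `v` generate a nonzero finitely generated `ℤ`-module stable under `η`, since
  -- each `η * v y` is a sum of entries of `v`.
  refine isIntegral_of_smul_mem_submodule (Submodule.span ℤ (Set.range v)) ?_
    (Submodule.fg_span (Set.finite_range v)) η fun n hn => ?_
  · intro hbot
    refine hv0 (funext fun y => ?_)
    exact Submodule.span_eq_bot.1 hbot _ ⟨y, rfl⟩
  · induction hn using Submodule.span_induction with
    | mem n hn =>
      obtain ⟨y, rfl⟩ := hn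
      by_cases hy : G.dist x y = 1
      · rw [smul_eq_mul, ← hη y hy]
        refine sum_mem fun z _ => ?_
        by_cases hz : G.dist y z = 1
        · simpa [distanceMatrix, hz] using Submodule.subset_span (Set.mem_range_self z)
        · simp [distanceMatrix, hz]
      · simp [hv y hy]
    | zero => simp
    | add a b _ _ ha hb => simpa [mul_add] using add_mem ha hb
    | smul c a _ ha =>
      rw [smul_comm]
      exact Submodule.smul_mem _ c ha

/-- The parameter `η̃` is never the valency. -/
theorem IsDistanceRegularWith.etaTilde_ne_valency (hG : G.IsDistanceRegularWith p) (hD : 2 ≤ G.diam)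
    {η : ℂ}
    (hη : IsIntegral ℤ η) (hη1 : 1 + η ≠ 0) :
    -1 - (p 1 1 2 : ℂ) / (1 + η) ≠ p 0 1 1 := by
  intro h
  have hval := hG.valency_eq hD
  have hb := hG.intersection_add_right_ne_zero (i := 1) (j := 1) hD
  rw [show 1 + 1 = 2 from rfl] at hb
  have hmul : (1 + η) * ((p 0 1 1 : ℂ) + 1) = -(p 1 1 2 : ℂ) := by
    rw [← h]
    field_simp
    ring
  have hk : ((p 0 1 1 : ℂ) + 1) ≠ 0 := by exact_mod_cast (p 0 1 1).succ_ne_zero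
  have hrat : 1 + η = algebraMap ℚ ℂ (-(p 1 1 2 : ℚ) / ((p 0 1 1 : ℚ) + 1)) := by
    rw [eq_ratCast]
    push_cast
    rw [eq_div_iff hk, hmul]
  -- A rational algebraic integer is an integer, so `k + 1` divides `b₁`, although `0 < b₁ < k + 1`.
  have hint : IsIntegral ℤ (1 + η) := isIntegral_one.add hη
  rw [hrat, isIntegral_algebraMap_iff (algebraMap ℚ ℂ).injective,
    IsIntegrallyClosed.isIntegral_iff] at hint
  obtain ⟨n, hn⟩ := hint
  rw [← hn] at hrat
  have hnη : 1 + η = (n : ℂ) := by simpa using hrat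
  rw [hnη] at hmul
  have hmul' : n * ((p 0 1 1 : ℤ) + 1) = -(p 1 1 2 : ℤ) := by exact_mod_cast hmul
  have hdvd : ((p 0 1 1 : ℤ) + 1) ∣ (p 1 1 2 : ℤ) := ⟨-n, by linear_combination hmul'⟩
  have := Int.le_of_dvd (by omega) hdvd
  omega

variable [DecidableEq X] {W : Submodule ℂ (X → ℂ)}

/-! ### Nonvanishing of `A_i v` and the dimension bound. -/

namespace IsDistanceRegularWith

/-- If `A_D v = 0`, expanding `A_{D-2} A_D v` and then `A_{D-1} A_D v` on the first sphere gives
`A_2 v = 0` and `A_1 v = 0` there. Then `J v = 0` leaves `v = 0`. -/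
theorem distanceMatrix_diam_mulVec_ne_zero (hG : G.IsDistanceRegularWith p) (hD : 3 ≤ G.diam)
    (hv : ∀ z, G.dist x z ≠ 1 → v z = 0) (hsum : ∑ z, v z = 0) (hv0 : v ≠ 0) :
    G.distanceMatrix G.diam *ᵥ v ≠ 0 := by
  intro hzero
  -- Here `D` is the diameter minus 2.
  obtain ⟨D, hDe⟩ : ∃ D, G.diam = D + 2 := ⟨G.diam - 2, by omega⟩
  refine hv0 (funext fun y => ?_)
  by_cases hy : G.dist x y = 1
  swap
  · exact hv y hy
  have hexp : ∀ i, i ≤ G.diam → ∑ h ∈ Finset.range (G.diam + 1),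
      (p h i G.diam : ℂ) * (G.distanceMatrix h *ᵥ v) y = 0 := by
    intro i hi
    rw [← hG.distanceMatrix_mulVec_mulVec hi le_rfl, hzero, Matrix.mulVec_zero, Pi.zero_apply]
  have h2 : (G.distanceMatrix 2 *ᵥ v) y = 0 := by
    have h := hexp D (by omega)
    rw [Finset.sum_eq_single_of_mem 2 (Finset.mem_range.2 (by omega))] at h
    · refine (mul_eq_zero.1 h).resolve_left ?_
      have := hG.intersection_add_right_ne_zero (i := 2) (j := D) (by omega)
      rw [show 2 + D = G.diam by omega] at this
      exact_mod_cast this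
    · intro h hh hne
      have := Finset.mem_range.1 hh
      rcases Nat.lt_or_ge h 2 with h2 | h2
      · rw [hG.intersection_eq_zero (by omega) (by omega) (by omega) (by omega)]
        simp
      · rw [hG.1.distanceMatrix_mulVec_eq_zero_of_far hv (by omega), mul_zero]
  have h1 : (G.distanceMatrix 1 *ᵥ v) y = 0 := by
    have h := hexp (D + 1) (by omega)
    rw [Finset.sum_eq_single_of_mem 1 (Finset.mem_range.2 (by omega))] at h
    · refine (mul_eq_zero.1 h).resolve_left ?_
      have := hG.intersection_add_right_ne_zero (i := 1) (j := D + 1) (by omega)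
      rw [show 1 + (D + 1) = G.diam by omega] at this
      exact_mod_cast this
    · intro h hh hne
      have := Finset.mem_range.1 hh
      rcases Nat.lt_trichotomy h 2 with h2' | rfl | h2'
      · rw [hG.intersection_eq_zero (by omega) (by omega) (by omega) (by omega)]
        simp
      · rw [h2, mul_zero]
      · rw [hG.1.distanceMatrix_mulVec_eq_zero_of_far hv (by omega), mul_zero]
  have h := hG.1.distanceMatrix_mulVec_add_eq_zero hv hsum (i := 0) hy
  rw [zero_add, zero_add, h1, h2, hG.1.distanceMatrix_zero, Matrix.one_mulVec] at h
  simpa using h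

/-- The raised images of `v` do not vanish before the last sphere. -/
theorem exists_distanceMatrix_mulVec_ne_zero (hG : G.IsDistanceRegularWith p) (hD : 3 ≤ G.diam)
    (hW : G.IsIrreducibleTModule x W) (hthin : G.IsThin x W) (hvW : v ∈ W)
    (hv : ∀ z, G.dist x z ≠ 1 → v z = 0) (hsum : ∑ z, v z = 0) (hv0 : v ≠ 0) (i : ℕ)
    (hi : i + 1 < G.diam) : ∃ y, G.dist x y = i + 1 ∧ (G.distanceMatrix i *ᵥ v) y ≠ 0 := by
  induction i with
  | zero =>
    obtain ⟨y, hy⟩ := Function.ne_iff.1 hv0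
    refine ⟨y, by_contra fun h => hy (hv y h), ?_⟩
    rwa [hG.1.distanceMatrix_zero, Matrix.one_mulVec]
  | succ i ih =>
    obtain ⟨y₀, hy₀, hne⟩ := ih (by omega)
    by_contra! hzero
    -- If `A_{i+1} v` vanishes on sphere `i + 2`, then `A` does not raise `A_i v`, so `W` vanishes
    -- beyond sphere `i + 1`. But `A_D v` lives on spheres `D - 1` and `D`, both beyond it, so it
    -- would be zero.
    refine hG.distanceMatrix_diam_mulVec_ne_zero hD hv hsum hv0 (funext fun y => ?_)
    rcases Nat.lt_or_ge (G.dist x y + 1) G.diam with h | h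
    · exact hG.1.distanceMatrix_mulVec_eq_zero_of_far hv (Or.inl h)
    refine hW.eq_zero_of_raising hG.1 hthin (w := G.distanceMatrix i *ᵥ v)
      (mulVec_mem_of_mem_boseMesner hW.1 (hG.distanceMatrix_mem_boseMesner i (by omega)) hvW)
      (fun y hy => hG.1.distanceMatrix_mulVec_eq_zero_of_far hv (Or.inr hy)) hy₀ hne ?_ _
      (mulVec_mem_of_mem_boseMesner hW.1 (hG.distanceMatrix_mem_boseMesner _ le_rfl) hvW) y
      (by omega)
    intro y hy
    rw [hG.distanceMatrix_mulVec_mulVec (by omega) (by omega)]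
    refine Finset.sum_eq_zero fun h hh => ?_
    have := Finset.mem_range.1 hh
    rcases Nat.lt_trichotomy h (i + 1) with h' | rfl | h'
    · rw [hG.1.distanceMatrix_mulVec_eq_zero_of_far hv (by omega), mul_zero]
    · rw [hzero y hy, mul_zero]
    · rw [hG.intersection_eq_zero (by omega) (by omega) (by omega) (by omega)]
      simp

/-- An element of `(M; v)` whose last two coefficients agree is a multiple of `J`. -/
theorem coeff_const_of_mulVec_mem (hG : G.IsDistanceRegularWith p) (hD : 3 ≤ G.diam)
    (hW : G.IsIrreducibleTModule x W) (hthin : G.IsThin x W) (hvW : v ∈ W)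
    (hv : ∀ z, G.dist x z ≠ 1 → v z = 0) (hsum : ∑ z, v z = 0) (hv0 : v ≠ 0)
    {P : Matrix X X ℂ} {ρ : ℕ → ℂ} (hρ : ∀ y z, P y z = ρ (G.dist y z))
    (hP : P *ᵥ v ∈ G.dualComponent x G.diam ⊤) (hlast : ρ (G.diam - 1) = ρ G.diam) :
    P = ρ G.diam • Matrix.of fun _ _ => 1 := by
  -- Downward induction on the index, carrying two consecutive coefficients.
  have key : ∀ n, n < G.diam → ρ (G.diam - (n + 1)) = ρ G.diam ∧ ρ (G.diam - n) = ρ G.diam := by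
    intro n
    induction n with
    | zero => exact fun _ => ⟨hlast, rfl⟩
    | succ n ih =>
      intro hn
      obtain ⟨h1, h2⟩ := ih (by omega)
      refine ⟨?_, h1⟩
      obtain ⟨i, hi⟩ : ∃ i, G.diam = i + (n + 2) := ⟨G.diam - (n + 2), by omega⟩
      obtain ⟨y, hy, hne⟩ := hG.exists_distanceMatrix_mulVec_ne_zero hD hW hthin hvW hv hsum hv0
        i (by omega)
      have hz := mem_dualComponent_top.1 hP y (by omega)
      rw [hG.1.mulVec_apply_of_dist hv hρ hy] at hz
      rw [show G.diam - (n + 1) = i + 1 by omega] at h1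
      rw [show G.diam - n = i + 2 by omega] at h2
      have hJ := hG.1.distanceMatrix_mulVec_add_eq_zero hv hsum hy
      rw [h1, h2] at hz
      rw [show G.diam - (n + 1 + 1) = i by omega]
      refine sub_eq_zero.1 ((mul_eq_zero.1 ?_).resolve_right hne)
      linear_combination hz - ρ G.diam * hJ
  ext y z
  rw [hρ]
  have hle := hG.1.dist_le_diam_of_fintype y z
  rw [Matrix.smul_apply, Matrix.of_apply, smul_eq_mul, mul_one]
  rcases Nat.eq_zero_or_pos (G.dist y z) with h | h
  · have := (key (G.diam - 1) (by omega)).1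
    rwa [show G.diam - (G.diam - 1 + 1) = G.dist y z by omega] at this
  · have := (key (G.diam - G.dist y z) (by omega)).2
    rwa [show G.diam - (G.diam - G.dist y z) = G.dist y z by omega] at this

/-! ### Pseudo primitive idempotents send `v` to the last sphere. -/

section LocalEigenvector

variable {η : ℂ}

theorem distanceMatrix_two_mulVec_apply (hG : G.IsDistanceRegularWith p)
    (hv : ∀ z, G.dist x z ≠ 1 → v z = 0) (hsum : ∑ z, v z = 0)
    (hη : ∀ y, G.dist x y = 1 → (G.distanceMatrix 1 *ᵥ v) y = η * v y) {y : X}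
    (hy : G.dist x y = 1) : (G.distanceMatrix 2 *ᵥ v) y = -(1 + η) * v y := by
  have h := hG.1.distanceMatrix_mulVec_add_eq_zero hv hsum (i := 0) hy
  rw [zero_add, zero_add, hη y hy, hG.1.distanceMatrix_zero, Matrix.one_mulVec] at h
  linear_combination h

/-- For local eigenvalue `-1` the vectors `A_{i+1} v` vanish within distance `i`. -/
theorem distanceMatrix_mulVec_eq_zero_of_eta_eq_neg_one (hG : G.IsDistanceRegularWith p)
    (hW : G.IsIrreducibleTModule x W) (hthin : G.IsThin x W) (hvW : v ∈ W)
    (hv : ∀ z, G.dist x z ≠ 1 → v z = 0) (hsum : ∑ z, v z = 0) (hv0 : v ≠ 0)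
    (hη : ∀ y, G.dist x y = 1 → (G.distanceMatrix 1 *ᵥ v) y = (-1) * v y) (i : ℕ)
    (hi : i + 2 ≤ G.diam) :
    ∀ y, G.dist x y ≤ i + 1 → (G.distanceMatrix (i + 2) *ᵥ v) y = 0 := by
  induction i with
  | zero =>
    intro y hy
    rcases Nat.lt_or_ge (G.dist x y) 1 with h | h
    · exact hG.1.distanceMatrix_mulVec_eq_zero_of_far hv (by omega)
    · rw [zero_add, hG.distanceMatrix_two_mulVec_apply hv hsum hη (by omega)]
      ring
  | succ i ih =>
    have hlow : ∀ y, G.dist x y ≤ i + 1 → (G.distanceMatrix (i + 1 + 2) *ᵥ v) y = 0 :=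
      fun y hy => hG.1.distanceMatrix_mulVec_eq_zero_of_far hv (by omega)
    have hend : ∃ u ∈ W, ∃ y, G.dist x y ≤ i + 1 ∧ u y ≠ 0 := by
      obtain ⟨y, hy⟩ := Function.ne_iff.1 hv0
      have : G.dist x y = 1 := by_contra fun h => hy (hv y h)
      exact ⟨v, hvW, y, by omega, hy⟩
    intro y hy
    rcases Nat.lt_or_ge (i + 1) (G.dist x y) with h | h
    swap
    · exact hlow y h
    refine hW.eq_zero_of_lowering hG.1 hthin hend
      (mulVec_mem_of_mem_boseMesner hW.1 (hG.distanceMatrix_mem_boseMesner _ hi) hvW) hlow ?_ y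
      (by omega)
    -- On sphere `i + 1`, only the `A_{i+2} v` term of `A A_{i+3} v` could survive, and the
    -- induction hypothesis kills it.
    intro y hy
    rw [hG.distanceMatrix_mulVec_mulVec (by omega) hi]
    refine Finset.sum_eq_zero fun h hh => ?_
    have := Finset.mem_range.1 hh
    rcases Nat.lt_trichotomy h (i + 2) with h' | rfl | h'
    · rw [hG.intersection_eq_zero (by omega) (by omega) (by omega) (by omega)]
      simp
    · rw [ih (by omega) y (by omega), mul_zero]
    · rw [hG.1.distanceMatrix_mulVec_eq_zero_of_far hv (by omega), mul_zero]

/-- A pseudo primitive idempotent for `η̃` maps `v` into the last component. -/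
theorem mulVec_eq_zero_of_mem_pseudoSpaceFinite (hG : G.IsDistanceRegularWith p)
    (hD : 3 ≤ G.diam) (hW : G.IsIrreducibleTModule x W) (hthin : G.IsThin x W) (hvW : v ∈ W)
    (hv : ∀ z, G.dist x z ≠ 1 → v z = 0) (hsum : ∑ z, v z = 0) (hv0 : v ≠ 0)
    (hη : ∀ y, G.dist x y = 1 → (G.distanceMatrix 1 *ᵥ v) y = η * v y) (hη1 : 1 + η ≠ 0)
    {P : Matrix X X ℂ} (hP : P ∈ G.pseudoSpaceFinite (-1 - (p 1 1 2 : ℂ) / (1 + η))) (m : ℕ)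
    (hm : m + 2 ≤ G.diam) : ∀ y, G.dist x y ≤ m + 1 → (P *ᵥ v) y = 0 := by
  obtain ⟨ρ, hρ⟩ := hG.exists_eq_dist_of_mem_boseMesner hP.1
  induction m with
  | zero =>
    intro y hy
    rcases Nat.lt_or_ge (G.dist x y) 1 with h | h
    · obtain rfl := hG.1.dist_eq_zero_iff.1 (Nat.lt_one_iff.1 h)
      have : (P *ᵥ v) x = ρ 1 * (G.distanceMatrix 1 *ᵥ v) x := by
        simp only [Matrix.mulVec, dotProduct, Finset.mul_sum]
        refine Finset.sum_congr rfl fun z _ => ?_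
        by_cases hz : G.dist x z = 1
        · simp [hρ, distanceMatrix, hz]
        · simp [hv z hz]
      rw [this, distanceMatrix_mulVec_center hv hsum, mul_zero]
    · have hy1 : G.dist x y = 1 := by omega
      have hb : (p 1 1 2 : ℂ) ≠ 0 := by
        exact_mod_cast hG.intersection_add_right_ne_zero (i := 1) (j := 1) (by omega)
      have hrec := hG.pseudo_recurrence hD hP hρ
      -- This is where `η̃` enters: `η̃ + 1 = -b₁ / (1 + η)`. On sphere 1, `P v` is `v` times `ρ₀ +
      -- η ρ₁ - (1 + η) ρ₂`, which is now zero.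
      have hdiff : (1 + η) * (ρ 2 - ρ 1) = -(ρ 1 - ρ 0) := by
        refine mul_left_cancel₀ hb ?_
        rw [mul_left_comm, hrec]
        field_simp
        ring
      rw [hG.1.mulVec_apply_of_dist hv hρ (i := 0) hy1, zero_add, zero_add,
        hG.distanceMatrix_two_mulVec_apply hv hsum hη hy1, hη y hy1, hG.1.distanceMatrix_zero,
        Matrix.one_mulVec]
      linear_combination (-v y) * hdiff
  | succ m ih =>
    have hlow := ih (by omega)
    have hend : ∃ u ∈ W, ∃ y, G.dist x y ≤ m + 1 ∧ u y ≠ 0 := by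
      obtain ⟨y, hy⟩ := Function.ne_iff.1 hv0
      have : G.dist x y = 1 := by_contra fun h => hy (hv y h)
      exact ⟨v, hvW, y, by omega, hy⟩
    intro y hy
    rcases Nat.lt_or_ge (m + 1) (G.dist x y) with h | h
    swap
    · exact hlow y h
    refine hW.eq_zero_of_lowering hG.1 hthin hend (mulVec_mem_of_mem_boseMesner hW.1 hP.1 hvW)
      hlow ?_ y (by omega)
    intro y hy
    -- Sphere `m + 1` comes before sphere `D - 1`, so `A_D v`, hence `(A - η̃) P v`, vanishes there.
    obtain ⟨c, hc⟩ := Submodule.mem_span_singleton.1 hP.2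
    have h := congrFun (congrArg (· *ᵥ v) hc) y
    simp only [Matrix.smul_mulVec, ← Matrix.mulVec_mulVec, Matrix.sub_mulVec, Pi.smul_apply,
      Pi.sub_apply, Matrix.one_mulVec, smul_eq_mul] at h
    rw [hlow y (by omega), hG.1.distanceMatrix_mulVec_eq_zero_of_far hv (by omega)] at h
    linear_combination -h

end LocalEigenvector

end IsDistanceRegularWith

end SimpleGraph

/-! ### Membership, independence and the basis. -/

namespace SimpleGraph

variable {X : Type*} [Fintype X] [DecidableEq X] {G : SimpleGraph X} {p : ℕ → ℕ → ℕ → ℕ} {x : X}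
  {v : X → ℂ} {W : Submodule ℂ (X → ℂ)} {η : ℂ} {E : Matrix X X ℂ}

theorem IsLocalEigenvalue.mulVec_apply (hη : G.IsLocalEigenvalue x W η) (hvW : v ∈ W)
    (hv : ∀ z, G.dist x z ≠ 1 → v z = 0) {y : X} (hy : G.dist x y = 1) :
    (G.distanceMatrix 1 *ᵥ v) y = η * v y := by
  have hfix : G.dualIdempotent x 1 *ᵥ v = v := by
    ext z
    rw [dualIdempotent_mulVec_apply]
    split_ifs with hz
    · rfl
    · exact (hv z hz).symm
  have h := congrFun (hη.2 v ⟨v, hvW, hfix⟩) y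
  rwa [← Matrix.mulVec_mulVec, ← Matrix.mulVec_mulVec, hfix, dualIdempotent_mulVec_apply,
    if_pos hy] at h

namespace IsDistanceRegularWith

theorem allOnes_mem_boseMesnerSub (hG : G.IsDistanceRegularWith p) (hsum : ∑ z, v z = 0) :
    (Matrix.of fun _ _ => 1 : Matrix X X ℂ) ∈ G.boseMesnerSub x v := by
  refine ⟨hG.allOnes_mem_boseMesner, ?_⟩
  have : (Matrix.of fun _ _ => 1 : Matrix X X ℂ) *ᵥ v = 0 := by
    ext y
    simpa [Matrix.mulVec, dotProduct] using hsum
  rw [this]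
  exact zero_mem _

theorem pseudoPrimitiveIdempotent_mem_boseMesnerSub (hG : G.IsDistanceRegularWith p)
    (hD : 3 ≤ G.diam) (hW : G.IsIrreducibleTModule x W) (hthin : G.IsThin x W) (hvW : v ∈ W)
    (hv : ∀ z, G.dist x z ≠ 1 → v z = 0) (hsum : ∑ z, v z = 0) (hv0 : v ≠ 0)
    (hη : ∀ y, G.dist x y = 1 → (G.distanceMatrix 1 *ᵥ v) y = η * v y)
    (hE : E ∈ G.pseudoSpace (etaTilde (p 1 1 2) (η : OnePoint ℂ))) :
    E ∈ G.boseMesnerSub x v := by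
  have hlt : ∀ y, G.dist x y ≠ G.diam → G.dist x y ≤ G.diam - 2 + 1 := fun y hy => by
    have := hG.1.dist_le_diam_of_fintype x y
    omega
  by_cases h1 : η = -1
  · subst h1
    have hE' : E ∈ Submodule.span ℂ {G.distanceMatrix G.diam} := by
      simpa [etaTilde, pseudoSpace] using hE
    obtain ⟨c, rfl⟩ := Submodule.mem_span_singleton.1 hE'
    refine Submodule.smul_mem _ c ⟨hG.distanceMatrix_mem_boseMesner _ le_rfl, ?_⟩
    refine mem_dualComponent_top.2 fun y hy => ?_
    have := hG.distanceMatrix_mulVec_eq_zero_of_eta_eq_neg_one hW hthin hvW hv hsum hv0 hη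
      (G.diam - 2) (by omega) y (hlt y hy)
    rwa [show G.diam - 2 + 2 = G.diam by omega] at this
  · have hE' : E ∈ G.pseudoSpaceFinite (-1 - (p 1 1 2 : ℂ) / (1 + η)) := by
      simpa [etaTilde, pseudoSpace, h1] using hE
    have h1' : 1 + η ≠ 0 := fun h => h1 (by linear_combination h)
    exact ⟨hE'.1, mem_dualComponent_top.2 fun y hy =>
      hG.mulVec_eq_zero_of_mem_pseudoSpaceFinite hD hW hthin hvW hv hsum hv0 hη h1' hE'
        (G.diam - 2) (by omega) y (hlt y hy)⟩

/-- Compare diagonal entries: `A_D` has zero diagonal, whereas `J` has diagonal 1 and `(A - θ) J`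
has diagonal `k - θ`. -/
theorem pseudoPrimitiveIdempotent_ne_smul_allOnes (hG : G.IsDistanceRegularWith p)
    (hD : 3 ≤ G.diam) (hη : IsIntegral ℤ η)
    (hE : G.IsPseudoPrimitiveIdempotent (etaTilde (p 1 1 2) (η : OnePoint ℂ)) E) (r : ℂ) :
    E ≠ r • Matrix.of fun _ _ => 1 := by
  obtain ⟨hE, hE0⟩ := hE
  rintro rfl
  have hr : r ≠ 0 := by
    rintro rfl
    exact hE0 (zero_smul _ _)
  obtain ⟨y⟩ := hG.1.nonempty
  by_cases h1 : η = -1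
  · subst h1
    have hE' : r • (Matrix.of fun _ _ => 1 : Matrix X X ℂ) ∈
        Submodule.span ℂ {G.distanceMatrix G.diam} := by
      simpa only [etaTilde, pseudoSpace, OnePoint.elim_some, OnePoint.elim_infty, if_true] using hE
    obtain ⟨c, hc⟩ := Submodule.mem_span_singleton.1 hE'
    have h := congrFun (congrFun hc y) y
    have hne : 0 ≠ G.diam := by omega
    simp [distanceMatrix, hne] at h
    exact hr h.symm
  · have hE' : r • (Matrix.of fun _ _ => 1 : Matrix X X ℂ) ∈
        G.pseudoSpaceFinite (-1 - (p 1 1 2 : ℂ) / (1 + η)) := by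
      simpa only [etaTilde, pseudoSpace, OnePoint.elim_some, if_neg h1] using hE
    obtain ⟨c, hc⟩ := Submodule.mem_span_singleton.1 hE'.2
    have h := congrFun (congrFun hc y) y
    have hne : 0 ≠ G.diam := by omega
    have hAJ : (G.distanceMatrix 1 * (Matrix.of fun _ _ => 1 : Matrix X X ℂ)) y y = p 0 1 1 := by
      rw [Matrix.mul_apply, ← hG.sum_distanceMatrix_one (by omega) y]
      simp
    rw [mul_smul_comm, sub_mul, smul_mul_assoc, one_mul, Matrix.smul_apply, Matrix.smul_apply,
      Matrix.sub_apply, hAJ, distanceMatrix, Matrix.of_apply, dist_self, if_neg hne,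
      Matrix.smul_apply, Matrix.of_apply] at h
    simp only [smul_eq_mul, mul_zero, mul_one] at h
    have h2 := (mul_eq_zero.1 h.symm).resolve_left hr
    exact hG.etaTilde_ne_valency (by omega) hη (fun h => h1 (by linear_combination h))
      (sub_eq_zero.1 h2).symm

end IsDistanceRegularWith

end SimpleGraph

theorem theorem1p2 {X : Type*} [Fintype X] [DecidableEq X] (G : SimpleGraph X)
    (p : ℕ → ℕ → ℕ → ℕ) (hG : G.IsDistanceRegularWith p) (hD : 3 ≤ G.diam) (x : X)
    (v : X → ℂ) (hv0 : v ≠ 0) (hv1 : v ∈ G.dualComponent x 1 ⊤)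
    (hvs : v ⬝ᵥ star (G.sphereVector x 1) = 0)
    (W : Submodule ℂ (X → ℂ)) (hW : G.IsIrreducibleTModule x W) (hthin : G.IsThin x W)
    (hend : G.HasEndpoint x W 1) (hvW : v ∈ W)
    (η : ℂ) (hη : G.IsLocalEigenvalue x W η)
    (E : Matrix X X ℂ)
    (hE : G.IsPseudoPrimitiveIdempotent (SimpleGraph.etaTilde (p 1 1 2) (η : OnePoint ℂ)) E) :
    ∃ β : Module.Basis (Fin 2) ℂ (G.boseMesnerSub x v),
      (β 0 : Matrix X X ℂ) = Matrix.of (fun _ _ => 1) ∧ (β 1 : Matrix X X ℂ) = E := by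
  have hv := SimpleGraph.mem_dualComponent_top.1 hv1
  have hsum : ∑ z, v z = 0 := by
    rw [← hvs]
    refine Finset.sum_congr rfl fun z _ => ?_
    by_cases hz : G.dist x z = 1
    · simp [SimpleGraph.sphereVector, hz]
    · simp [hv z hz]
  have hηv : ∀ y, G.dist x y = 1 → (G.distanceMatrix 1 *ᵥ v) y = η * v y :=
    fun y hy => hη.mulVec_apply hvW hv hy
  have hJmem : (Matrix.of fun _ _ => 1 : Matrix X X ℂ) ∈ G.boseMesnerSub x v :=
    hG.allOnes_mem_boseMesnerSub hsum
  have hEmem : E ∈ G.boseMesnerSub x v :=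
    hG.pseudoPrimitiveIdempotent_mem_boseMesnerSub hD hW hthin hvW hv hsum hv0 hηv hE.1
  have hEJ := hG.pseudoPrimitiveIdempotent_ne_smul_allOnes hD
    (SimpleGraph.isIntegral_of_mulVec_eq hv hv0 hηv) hE
  obtain ⟨ε, hε⟩ := hG.exists_eq_dist_of_mem_boseMesner hEmem.1
  have hεne : ε (G.diam - 1) - ε G.diam ≠ 0 := fun h =>
    hEJ _ (hG.coeff_const_of_mulVec_mem hD hW hthin hvW hv hsum hv0 hε hEmem.2 (sub_eq_zero.1 h))
  have hX := hG.1.nonempty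
  let b : Fin 2 → G.boseMesnerSub x v := ![⟨_, hJmem⟩, ⟨E, hEmem⟩]
  have hli : LinearIndependent ℂ b := by
    refine (LinearIndependent.pair_iff' fun h => ?_).2 fun a h => hEJ a ?_
    · obtain ⟨y⟩ := hX
      exact one_ne_zero (congrFun (congrFun (congrArg Subtype.val h) y) y)
    · exact (congrArg Subtype.val h).symm
  have hspan : ⊤ ≤ Submodule.span ℂ (Set.range b) := by
    rintro ⟨P, hP⟩ -
    obtain ⟨ρ, hρ⟩ := hG.exists_eq_dist_of_mem_boseMesner hP.1
    -- Chosen so that the last two coefficients of `P - c • E` agree, which makes it a multiple of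
    -- `J`.
    set c := (ρ (G.diam - 1) - ρ G.diam) / (ε (G.diam - 1) - ε G.diam) with hc
    have hcε : c * (ε (G.diam - 1) - ε G.diam) = ρ (G.diam - 1) - ρ G.diam :=
      div_mul_cancel₀ _ hεne
    have hdiff := hG.coeff_const_of_mulVec_mem hD hW hthin hvW hv hsum hv0
      (P := P - c • E) (ρ := fun i => ρ i - c * ε i) (fun y z => by simp [hρ, hε])
      (sub_mem hP (Submodule.smul_mem _ c hEmem)).2 (by linear_combination -hcε)
    rw [Matrix.range_cons, Matrix.range_cons, Matrix.range_empty, Set.union_empty,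
      Set.singleton_union, Submodule.mem_span_pair]
    exact ⟨_, c, Subtype.ext (sub_eq_iff_eq_add.1 hdiff).symm⟩
  exact ⟨Module.Basis.mk hli hspan, by simp [b], by simp [b]⟩
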